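/- Let $f:\mathbb{R}\to\mathbb{C}$ be a bounded continuous function with $f(0)=1$, and for $z\in\mathbb{C}\setminus\mathbb{R}$ let $$K_f(z)=\frac{i}{\pi}\int_{-\infty}^{\infty}\Bigl(\frac{1}{z-t}+\frac{t}{t^2+1}\Bigr)f(t)\,dt$$ be its modified Cauchy transform (the integral converges absolutely). Then $f$ is a characteristic function, i.e. there is a Borel probability measure $\sigma$ on $\mathbb{R}$ with $f(x)=\int_{-\infty}^{\infty}e^{ixt}\,d\sigma(t)$ for all $x\in\mathbb{R}$, if and only if there is a constant $a_f\in\mathbb{R}$ such that both of the following hold: (i) the function $y\mapsto a_f+K_f(iy)$ is completely monotonic on $(0,\infty)$, i.e. it is real-valued and infinitely differentiable there and $(-1)^n\frac{d^n}{dy^n}\bigl(a_f+K_f(iy)\bigr)\ge 0$ for all $y>0$ and all $n=0,1,2,\dots$; (ii) the function $y\mapsto -\bigl(a_f+K_f(iy)\bigr)$ is absolutely monotonic on $(-\infty,0)$, i.e. it is real-valued and infinitely differentiable there and $-\frac{d^n}{dy^n}\bigl(a_f+K_f(iy)\bigr)\ge 0$ for all $y<0$ and all $n=0,1,2,\dots$.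 -/

import Mathlib

open Set MeasureTheory
open scoped ContDiff

/-- The modified Cauchy transform
`K_f(z) = (i/π) ∫ (1/(z - t) + t/(t² + 1)) f(t) dt` of `f : ℝ → ℂ`.
For bounded measurable `f` and non-real `z` the integrand is `O(1/t²)` at infinity,
so the integral converges absolutely; the value at real `z` is irrelevant. -/
noncomputable def modifiedCauchyTransform (f : ℝ → ℂ) (z : ℂ) : ℂ :=
  (Complex.I / Real.pi) *
    ∫ t : ℝ, (1 / (z - (t : ℂ)) + ((t / (t ^ 2 + 1) : ℝ) : ℂ)) * f t

/-- A real function `g` is completely monotonic on the (open) interval `s` if it is infinitely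
differentiable there and `(-1)^n g^{(n)}(x) ≥ 0` for all `x ∈ s` and `n = 0, 1, 2, …`. -/
def CompletelyMonotonicOn (g : ℝ → ℝ) (s : Set ℝ) : Prop :=
  ContDiffOn ℝ ∞ g s ∧ ∀ n : ℕ, ∀ x ∈ s, 0 ≤ (-1) ^ n * iteratedDerivWithin n g s x

/-- `f` is the characteristic function `x ↦ ∫ exp(i x t) dσ(t)` of some Borel probability
measure `σ` on `ℝ`. -/
def IsCharacteristicFunction (f : ℝ → ℂ) : Prop :=
  ∃ σ : Measure ℝ, IsProbabilityMeasure σ ∧ ∀ x : ℝ, f x = charFun σ x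

/-! Necessity: for `f = charFun σ`, Fourier inversion and Fubini give `K_f(iy)` for `y > 0` as the
`σ`-integral of `cauchyTransformChar y`. Adding `a = ∫ sign(s) e^{-|s|} dσ` cancels every term
independent of `y` and leaves the Laplace transform of a positive measure on `[0, ∞)`, which is
completely monotonic. Reflecting `σ` turns the condition on `(-∞, 0)` into the same statement and
changes the sign of `a`.

Sufficiency: put `F(w) = a + K_f(iw)` and `G(w) = -a + K_{f(-·)}(iw)` on `Re w > 0`. Then `F(y - ix)
+ G(y + ix)` is `2/π` times a Poisson integral of `f`, with limit `2 f(x)` as `y → 0`. Bernstein's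
theorem is replaced by a Taylor expansion: around `y + r`, `F(y + r(1 - s))` is a power series in
`s` with nonnegative coefficients, so `s = e^{ix/r}` gives the transform of a measure on the points
`n/r`. Lévy's continuity theorem is applied as `r → ∞` and again as `y → 0`. -/

section

open Filter Topology

/-! ### Limits of characteristic functions. -/

/-- **Lévy continuity theorem**, existence part. -/
theorem exists_charFun_eq_of_tendsto {φ : ℝ → ℂ} (hφ : ContinuousAt φ 0) {μ : ℕ → Measure ℝ}
    [∀ n, IsProbabilityMeasure (μ n)]
    (h : ∀ t, Tendsto (fun n ↦ charFun (μ n) t) atTop (𝓝 (φ t))) :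
    IsCharacteristicFunction φ := by
  have htight := isTightMeasureSet_of_tendsto_charFun hφ h
  let ν : ℕ → ProbabilityMeasure ℝ := fun n ↦ ⟨μ n, inferInstance⟩
  have hcompact : IsCompact (closure (range ν)) := by
    refine isCompact_closure_of_isTightMeasureSet (htight.subset ?_)
    rintro _ ⟨_, ⟨n, rfl⟩, rfl⟩
    exact ⟨n, rfl⟩
  -- Only one limit point is needed, and compactness supplies it along any ultrafilter finer than
  -- `atTop`.
  let U : Ultrafilter ℕ := hyperfilter ℕ
  have hU : (U : Filter ℕ) ≤ atTop := Nat.hyperfilter_le_atTop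
  obtain ⟨σ, -, hσ⟩ := hcompact.ultrafilter_le_nhds (U.map ν)
    (by
      rw [le_principal_iff]
      exact mem_of_superset (Filter.range_mem_map (m := ν) (f := (U : Filter ℕ))) subset_closure)
  replace hσ : Tendsto ν U (𝓝 σ) := hσ
  refine ⟨σ, inferInstance, fun x ↦ tendsto_nhds_unique ((h x).mono_left hU) ?_⟩
  rw [ProbabilityMeasure.tendsto_iff_forall_integral_rclike_tendsto ℂ] at hσ
  simp_rw [charFun_eq_integral_innerProbChar]
  exact hσ (BoundedContinuousFunction.innerProbChar x)

/-! ### The Cauchy transform as a holomorphic function of `w = -iz`, `Re w > 0`. -/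

theorem add_I_mul_ofReal_ne_zero {w : ℂ} (hw : 0 < w.re) (t : ℝ) : w + Complex.I * t ≠ 0 := by
  intro h
  have := congrArg Complex.re h
  simp at this
  exact hw.ne' this

theorem re_le_norm_add_I_mul_ofReal (w : ℂ) (t : ℝ) : w.re ≤ ‖w + Complex.I * t‖ := by
  simpa using Complex.re_le_norm (w + Complex.I * t)

theorem one_add_ofReal_sq_ne_zero (t : ℝ) : (1 : ℂ) + (t : ℂ) ^ 2 ≠ 0 := by
  have : (1 + t ^ 2 : ℝ) ≠ 0 := by positivity
  exact_mod_cast this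

/-- This form separates the integrable weight `1/(1 + t²)` from a factor bounded in `t`, so that
only `(w + it)⁻¹` has to be differentiated under the integral. -/
theorem I_mul_kernel_eq {w : ℂ} (hw : 0 < w.re) (t : ℝ) :
    Complex.I * (1 / (Complex.I * w - (t : ℂ)) + ((t / (t ^ 2 + 1) : ℝ) : ℂ)) =
      (w + (1 - w ^ 2) / (w + Complex.I * t)) * ((1 + (t : ℂ) ^ 2)⁻¹) := by
  have h1 := add_I_mul_ofReal_ne_zero hw t
  have h2 := one_add_ofReal_sq_ne_zero t
  have h3 : Complex.I * w - (t : ℂ) = Complex.I * (w + Complex.I * t) := by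
    linear_combination -(t : ℂ) * Complex.I_mul_I
  have h4 : (t : ℂ) ^ 2 + 1 ≠ 0 := by rwa [add_comm]
  rw [h3]
  push_cast
  have hI := Complex.I_ne_zero
  field_simp
  ring_nf
  simp only [Complex.I_sq]
  ring

theorem modifiedCauchyTransform_I_mul (f : ℝ → ℂ) {w : ℂ} (hw : 0 < w.re) :
    modifiedCauchyTransform f (Complex.I * w) = (1 / Real.pi : ℂ) *
      ∫ t : ℝ, (w + (1 - w ^ 2) / (w + Complex.I * t)) * ((1 + (t : ℂ) ^ 2)⁻¹ * f t) := by
  rw [modifiedCauchyTransform, div_eq_mul_one_div, mul_comm Complex.I, mul_assoc,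
    ← integral_const_mul]
  congr 2
  ext t
  rw [← mul_assoc, I_mul_kernel_eq hw, mul_assoc]

/-- Exchanges the two half-planes, so the condition on `(-∞, 0)` becomes one on `(0, ∞)` for the
reflected function. -/
theorem modifiedCauchyTransform_comp_neg (f : ℝ → ℂ) (z : ℂ) :
    modifiedCauchyTransform (fun t ↦ f (-t)) z = -modifiedCauchyTransform f (-z) := by
  rw [modifiedCauchyTransform, modifiedCauchyTransform, ← mul_neg, ← integral_neg,
    ← integral_neg_eq_self]
  congr 2
  ext t
  simp only [neg_neg, Complex.ofReal_neg, even_two, Even.neg_pow, neg_div, sub_neg_eq_add]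
  rw [← neg_mul]
  congr 1
  rw [show -z - (t : ℂ) = -(z + t) by ring, div_neg]
  ring

theorem integrable_inv_one_add_sq_mul {f : ℝ → ℂ} (hcont : Continuous f) {M : ℝ}
    (hM : ∀ x, ‖f x‖ ≤ M) : Integrable fun t : ℝ ↦ (1 + (t : ℂ) ^ 2)⁻¹ * f t := by
  have h := (integrable_inv_one_add_sq.ofReal (𝕜 := ℂ)).mul_bdd (c := M)
    hcont.aestronglyMeasurable (.of_forall hM)
  simpa using h

theorem continuous_div_add_I_mul {w : ℂ} (hw : 0 < w.re) (b : ℂ) :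
    Continuous fun t : ℝ ↦ b / (w + Complex.I * t) :=
  continuous_const.div (by fun_prop) fun t ↦ add_I_mul_ofReal_ne_zero hw t

theorem norm_inv_add_I_mul_le {w : ℂ} {δ : ℝ} (hδ : 0 < δ) (hw : δ ≤ w.re) (t : ℝ) :
    ‖(w + Complex.I * t)⁻¹‖ ≤ δ⁻¹ := by
  rw [norm_inv]
  exact inv_anti₀ hδ (hw.trans (re_le_norm_add_I_mul_ofReal w t))

theorem integrable_inv_add_I_mul {u : ℝ → ℂ} (hu : Integrable u) {w : ℂ} (hw : 0 < w.re) :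
    Integrable fun t : ℝ ↦ (w + Complex.I * t)⁻¹ * u t := by
  refine hu.bdd_mul (c := (w.re)⁻¹) ?_ (.of_forall fun t ↦ norm_inv_add_I_mul_le hw le_rfl t)
  simpa using (continuous_div_add_I_mul hw 1).aestronglyMeasurable

theorem hasDerivAt_integral_inv_add_I_mul {u : ℝ → ℂ} (hu : Integrable u) {w : ℂ}
    (hw : 0 < w.re) :
    HasDerivAt (fun w : ℂ ↦ ∫ t : ℝ, (w + Complex.I * t)⁻¹ * u t)
      (∫ t : ℝ, -(w + Complex.I * t)⁻¹ ^ 2 * u t) w := by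
  have hδ : 0 < w.re / 2 := by positivity
  have hs : {z : ℂ | w.re / 2 < z.re} ∈ 𝓝 w :=
    (isOpen_lt continuous_const Complex.continuous_re).mem_nhds (by simp; linarith)
  refine (hasDerivAt_integral_of_dominated_loc_of_deriv_le
    (bound := fun t ↦ (w.re / 2)⁻¹ ^ 2 * ‖u t‖)
    (F := fun (w : ℂ) (t : ℝ) ↦ (w + Complex.I * t)⁻¹ * u t)
    (F' := fun (w : ℂ) (t : ℝ) ↦ -(w + Complex.I * t)⁻¹ ^ 2 * u t) hs ?_ ?_ ?_ ?_ ?_ ?_).2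
  · filter_upwards [hs] with z hz
    exact (integrable_inv_add_I_mul hu (hδ.trans hz)).aestronglyMeasurable
  · exact integrable_inv_add_I_mul hu hw
  · refine AEStronglyMeasurable.mul ?_ hu.aestronglyMeasurable
    have := (continuous_div_add_I_mul hw 1)
    simp only [one_div] at this
    exact (this.pow 2).neg.aestronglyMeasurable
  · refine .of_forall fun t z hz ↦ ?_
    rw [norm_mul, norm_neg, norm_pow]
    gcongr
    exact norm_inv_add_I_mul_le hδ (le_of_lt hz) t
  · exact hu.norm.const_mul _
  · refine .of_forall fun t z hz ↦ ?_
    have h0 := add_I_mul_ofReal_ne_zero (hδ.trans hz) t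
    have h := (((hasDerivAt_id z).add_const (Complex.I * t)).inv h0).mul_const (u t)
    exact h.congr_deriv (by simp [div_eq_mul_inv])

theorem modifiedCauchyTransform_I_mul_eq {f : ℝ → ℂ} (hcont : Continuous f) {M : ℝ}
    (hM : ∀ x, ‖f x‖ ≤ M) {w : ℂ} (hw : 0 < w.re) :
    modifiedCauchyTransform f (Complex.I * w) = (1 / Real.pi : ℂ) *
      (w * (∫ t : ℝ, (1 + (t : ℂ) ^ 2)⁻¹ * f t) + (1 - w ^ 2) *
        ∫ t : ℝ, (w + Complex.I * t)⁻¹ * ((1 + (t : ℂ) ^ 2)⁻¹ * f t)) := by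
  have hu := integrable_inv_one_add_sq_mul hcont hM
  rw [modifiedCauchyTransform_I_mul f hw, ← integral_const_mul w, ← integral_const_mul (1 - w ^ 2),
    ← integral_add (hu.const_mul _) ((integrable_inv_add_I_mul hu hw).const_mul _)]
  congr 2
  ext t
  rw [div_eq_mul_inv]
  ring

theorem differentiableOn_modifiedCauchyTransform {f : ℝ → ℂ} (hcont : Continuous f) {M : ℝ}
    (hM : ∀ x, ‖f x‖ ≤ M) :
    DifferentiableOn ℂ (fun w ↦ modifiedCauchyTransform f (Complex.I * w)) {w | 0 < w.re} := by
  have hu := integrable_inv_one_add_sq_mul hcont hM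
  have hd : DifferentiableOn ℂ
      (fun w : ℂ ↦ ∫ t : ℝ, (w + Complex.I * t)⁻¹ * ((1 + (t : ℂ) ^ 2)⁻¹ * f t))
      {w | 0 < w.re} := fun w hw ↦
    (hasDerivAt_integral_inv_add_I_mul hu hw).differentiableAt.differentiableWithinAt
  refine DifferentiableOn.congr ?_ fun w hw ↦ modifiedCauchyTransform_I_mul_eq hcont hM hw
  fun_prop

/-! ### From complete monotonicity to characteristic functions. -/

theorem ofReal_iteratedDerivWithin_Ioi_eq {F : ℂ → ℂ} (hF : DifferentiableOn ℂ F {w | 0 < w.re})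
    {g : ℝ → ℝ} (hg : ContDiffOn ℝ ∞ g (Ioi 0)) (hgF : ∀ y ∈ Ioi (0 : ℝ), (g y : ℂ) = F y)
    (n : ℕ) : ∀ y ∈ Ioi (0 : ℝ),
      ((iteratedDerivWithin n g (Ioi 0) y : ℝ) : ℂ) = iteratedDeriv n F y := by
  have hopen : IsOpen {w : ℂ | 0 < w.re} := isOpen_lt continuous_const Complex.continuous_re
  induction n with
  | zero => simpa using hgF
  | succ n ih =>
    intro y hy
    have hFn : DifferentiableAt ℂ (iteratedDeriv n F) (y : ℂ) := by
      rw [iteratedDeriv_eq_iterate]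
      exact ((hF.analyticAt (hopen.mem_nhds (by simpa using hy))).iterated_deriv n).differentiableAt
    have hgn : DifferentiableAt ℝ (iteratedDerivWithin n g (Ioi 0)) y :=
      ((hg.differentiableOn_iteratedDerivWithin (m := n)
        (by exact_mod_cast ENat.natCast_lt_top n) (uniqueDiffOn_Ioi 0)) y hy).differentiableAt
        (Ioi_mem_nhds hy)
    rw [iteratedDerivWithin_succ, iteratedDeriv_succ, derivWithin_of_mem_nhds (Ioi_mem_nhds hy)]
    refine hgn.hasDerivAt.ofReal_comp.unique ?_
    refine hFn.hasDerivAt.comp_ofReal.congr_of_eventuallyEq ?_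
    filter_upwards [Ioi_mem_nhds hy] with z hz using ih z hz

theorem exists_charFun_eq_tsum {c : ℕ → ℝ} (hc : ∀ n, 0 ≤ c n) (hs : Summable c) (x : ℕ → ℝ) :
    ∃ σ : Measure ℝ, IsFiniteMeasure σ ∧
      ∀ t : ℝ, HasSum (fun n ↦ (c n : ℂ) * Complex.exp (t * x n * Complex.I)) (charFun σ t) := by
  let μ : ℕ → Measure ℝ := fun n ↦ ENNReal.ofReal (c n) • Measure.dirac (x n)
  have hfin : IsFiniteMeasure (Measure.sum μ) := by
    refine ⟨?_⟩
    rw [Measure.sum_apply _ MeasurableSet.univ]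
    simpa [μ] using hs.tsum_ofReal_lt_top
  refine ⟨Measure.sum μ, hfin, fun t ↦ ?_⟩
  rw [charFun_apply_real]
  have hint : Integrable (fun v : ℝ ↦ Complex.exp (t * v * Complex.I)) (Measure.sum μ) := by
    refine Integrable.of_bound (C := 1) (by fun_prop) (.of_forall fun v ↦ ?_)
    rw [← Complex.ofReal_mul, Complex.norm_exp_ofReal_mul_I]
  refine HasSum.congr_fun (hasSum_integral_measure hint) fun n ↦ ?_
  simp [μ, ENNReal.toReal_ofReal (hc n)]

/-- The point `y + r(1 - s)` with `|s| = 1` lies at distance `r` from `y + r`, inside the disc of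
radius `y + r` where `F` is holomorphic. The Taylor coefficients in `s` are `(-1)ⁿ F⁽ⁿ⁾(y + r) rⁿ /
n! ≥ 0`; they become masses at `n/r`. -/
theorem exists_charFun_eq_of_completelyMonotone {F : ℂ → ℂ}
    (hF : DifferentiableOn ℂ F {w | 0 < w.re}) {D : ℕ → ℝ → ℝ}
    (hD : ∀ n, ∀ y ∈ Ioi (0 : ℝ), (D n y : ℂ) = iteratedDeriv n F y)
    (hD0 : ∀ n, ∀ y ∈ Ioi (0 : ℝ), 0 ≤ (-1) ^ n * D n y) {y r : ℝ} (hy : 0 < y) (hr : 0 < r) :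
    ∃ σ : Measure ℝ, IsFiniteMeasure σ ∧
      ∀ x : ℝ, charFun σ x = F (y + r * (1 - Complex.exp (x * Complex.I / r))) := by
  have hyr : 0 < y + r := by positivity
  have hball : DifferentiableOn ℂ F (Metric.ball ((y + r : ℝ) : ℂ) (y + r)) := by
    refine hF.mono fun w hw ↦ ?_
    rw [Metric.mem_ball, dist_eq_norm, ← norm_neg] at hw
    have := (Complex.re_le_norm _).trans_lt hw
    simpa using this
  let c : ℕ → ℝ := fun n ↦ (n.factorial : ℝ)⁻¹ * r ^ n * ((-1) ^ n * D n (y + r))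
  have hc : ∀ n, 0 ≤ c n := fun n ↦ mul_nonneg (by positivity) (hD0 n _ hyr)
  have key : ∀ s : ℂ, ‖s‖ = 1 → HasSum (fun n ↦ (c n : ℂ) * s ^ n) (F (y + r * (1 - s))) := by
    intro s hs
    have hmem : (y : ℂ) + r * (1 - s) ∈ Metric.ball ((y + r : ℝ) : ℂ) (y + r) := by
      rw [Metric.mem_ball, dist_eq_norm]
      have : (y : ℂ) + r * (1 - s) - ((y + r : ℝ) : ℂ) = -(r * s) := by push_cast; ring
      rw [this, norm_neg, norm_mul, hs, Complex.norm_real, Real.norm_of_nonneg hr.le]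
      linarith
    refine HasSum.congr_fun (Complex.hasSum_taylorSeries_on_ball hball hmem) fun n ↦ ?_
    rw [← hD n _ hyr]
    have : (y : ℂ) + r * (1 - s) - ((y + r : ℝ) : ℂ) = (-1) * (r * s) := by push_cast; ring
    rw [this]
    simp only [c, smul_eq_mul, mul_pow]
    push_cast
    ring
  -- The value `s = 1` shows that the total mass is `F(y)`.
  have hsum : Summable c := by
    have := (key 1 (by simp)).summable
    simpa using this
  obtain ⟨σ, hσ, h⟩ := exists_charFun_eq_tsum hc hsum fun n ↦ n / r
  refine ⟨σ, hσ, fun x ↦ (h x).unique ?_⟩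
  refine HasSum.congr_fun (key (Complex.exp (x * Complex.I / r)) ?_) fun n ↦ ?_
  · rw [mul_div_right_comm, ← Complex.ofReal_div, Complex.norm_exp_ofReal_mul_I]
  · rw [← Complex.exp_nat_mul]
    congr 2
    push_cast
    ring

theorem isCharacteristicFunction_charFun_div {σ : Measure ℝ} [IsFiniteMeasure σ]
    (h0 : charFun σ 0 ≠ 0) : IsCharacteristicFunction fun x ↦ charFun σ x / charFun σ 0 := by
  rw [charFun_zero] at h0 ⊢
  have : NeZero σ := ⟨by rintro rfl; simp at h0⟩
  refine ⟨(σ univ)⁻¹ • σ, inferInstance, fun x ↦ ?_⟩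
  simp only [charFun_apply_real, integral_smul_measure, ENNReal.toReal_inv, Complex.real_smul,
    Complex.ofReal_inv, Measure.real]
  rw [div_eq_inv_mul]

theorem isCharacteristicFunction_of_tendsto {φ : ℝ → ℂ} (hφ : ContinuousAt φ 0) {ψ : ℕ → ℝ → ℂ}
    (hψ : ∀ᶠ n in atTop, IsCharacteristicFunction (ψ n))
    (h : ∀ t, Tendsto (fun n ↦ ψ n t) atTop (𝓝 (φ t))) : IsCharacteristicFunction φ := by
  obtain ⟨N, hN⟩ := eventually_atTop.1 hψ
  choose σ hσ hσψ using fun n ↦ hN (n + N) (Nat.le_add_left N n)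
  refine exists_charFun_eq_of_tendsto hφ (μ := σ) fun t ↦ ?_
  simp_rw [← hσψ]
  exact (tendsto_add_atTop_iff_nat N).2 (h t)

theorem tendsto_mul_one_sub_exp (x : ℝ) :
    Tendsto (fun n : ℕ ↦ ((n + 1 : ℝ) : ℂ) * (1 - Complex.exp (x * Complex.I / (n + 1 : ℝ))))
      atTop (𝓝 (-(x * Complex.I))) := by
  have hd : HasDerivAt (fun s : ℝ ↦ Complex.exp (x * Complex.I * s)) (x * Complex.I) 0 := by
    have h := (((hasDerivAt_id (0 : ℂ)).const_mul (x * Complex.I)).cexp).comp_ofReal (z := 0)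
    simpa using h
  have h := (hd.tendsto_slope_zero_right.comp
    (tendsto_nhdsWithin_iff.2 ⟨tendsto_one_div_add_atTop_nhds_zero_nat (𝕜 := ℝ),
      .of_forall fun n ↦ by simp only [mem_Ioi]; positivity⟩)).neg
  refine h.congr fun n ↦ ?_
  have : ((n : ℂ) + 1) ≠ 0 := by exact_mod_cast n.succ_ne_zero
  simp [div_eq_mul_inv]
  ring

/-- With `r = n + 1 → ∞`, `r(1 - e^{ix/r})` tends to `-ix`. The masses for `G` are reflected to the
negative half-line, which turns `-ix` into `+ix`. -/
theorem isCharacteristicFunction_boundary_sum {F G : ℂ → ℂ}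
    (hF : DifferentiableOn ℂ F {w | 0 < w.re}) (hG : DifferentiableOn ℂ G {w | 0 < w.re})
    {D E : ℕ → ℝ → ℝ}
    (hD : ∀ n, ∀ y ∈ Ioi (0 : ℝ), (D n y : ℂ) = iteratedDeriv n F y)
    (hD0 : ∀ n, ∀ y ∈ Ioi (0 : ℝ), 0 ≤ (-1) ^ n * D n y)
    (hE : ∀ n, ∀ y ∈ Ioi (0 : ℝ), (E n y : ℂ) = iteratedDeriv n G y)
    (hE0 : ∀ n, ∀ y ∈ Ioi (0 : ℝ), 0 ≤ (-1) ^ n * E n y) {y : ℝ} (hy : 0 < y)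
    (hne : F y + G y ≠ 0) :
    IsCharacteristicFunction fun x : ℝ ↦
      (F (y - x * Complex.I) + G (y + x * Complex.I)) / (F y + G y) := by
  have hopen : IsOpen {w : ℂ | 0 < w.re} := isOpen_lt continuous_const Complex.continuous_re
  have hcont : ∀ {H : ℂ → ℂ}, DifferentiableOn ℂ H {w | 0 < w.re} → ∀ x : ℝ,
      ContinuousAt H (y + x * Complex.I) := fun hH x ↦
    (hH.differentiableAt (hopen.mem_nhds (by simpa using hy))).continuousAt
  have hlim : ∀ {H : ℂ → ℂ}, DifferentiableOn ℂ H {w | 0 < w.re} → ∀ x : ℝ,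
      Tendsto (fun n : ℕ ↦ H (y + ((n + 1 : ℝ) : ℂ) *
        (1 - Complex.exp (x * Complex.I / (n + 1 : ℝ))))) atTop (𝓝 (H (y - x * Complex.I))) := by
    intro H hH x
    have h := (tendsto_mul_one_sub_exp x).const_add (y : ℂ)
    rw [← sub_eq_add_neg] at h
    refine Tendsto.comp (g := H) ?_ h
    simpa [ContinuousAt, ← sub_eq_add_neg] using (hcont hH (-x)).tendsto
  refine isCharacteristicFunction_of_tendsto (ψ := fun (n : ℕ) (x : ℝ) ↦
    (F (y + ((n + 1 : ℝ) : ℂ) * (1 - Complex.exp (x * Complex.I / (n + 1 : ℝ)))) +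
      G (y + ((n + 1 : ℝ) : ℂ) * (1 - Complex.exp ((-x : ℝ) * Complex.I / (n + 1 : ℝ))))) /
      (F y + G y)) ?_ (.of_forall fun n ↦ ?_) fun x ↦ ?_
  · refine ContinuousAt.div_const (ContinuousAt.add ?_ ?_) _
    · refine ContinuousAt.comp (g := F) (f := fun x : ℝ ↦ (y : ℂ) - x * Complex.I) ?_ (by fun_prop)
      simpa using hcont hF 0
    · refine ContinuousAt.comp (g := G) (f := fun x : ℝ ↦ (y : ℂ) + x * Complex.I) ?_ (by fun_prop)
      simpa using hcont hG 0
  · have hn : (0 : ℝ) < n + 1 := by positivity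
    obtain ⟨σ, hσ, hσF⟩ := exists_charFun_eq_of_completelyMonotone hF hD hD0 hy hn
    obtain ⟨τ, hτ, hτG⟩ := exists_charFun_eq_of_completelyMonotone hG hE hE0 hy hn
    have hadd : ∀ x : ℝ, charFun (σ + τ.map (fun t ↦ -1 * t)) x = charFun σ x + charFun τ (-x) := by
      intro x
      rw [← neg_one_mul x, ← charFun_map_mul, charFun_apply_real, charFun_apply_real,
        charFun_apply_real, integral_add_measure] <;>
      refine Integrable.of_bound (C := 1) (by fun_prop) (.of_forall fun v ↦ ?_) <;>
      rw [← Complex.ofReal_mul, Complex.norm_exp_ofReal_mul_I]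
    have h0 : charFun (σ + τ.map (fun t ↦ -1 * t)) 0 = F y + G y := by
      rw [hadd, hσF, hτG]
      simp only [Complex.ofReal_zero, neg_zero]
      simp
    have h := isCharacteristicFunction_charFun_div (σ := σ + τ.map (fun t ↦ -1 * t)) (h0 ▸ hne)
    rw [h0] at h
    simpa only [hadd, hσF, hτG] using h
  · refine ((hlim hF x).add ?_).div_const _
    simpa [← sub_eq_add_neg] using hlim hG (-x)

/-! ### The Poisson integral and its boundary values. -/

theorem kernel_eq_inv_add {w : ℂ} (t : ℝ) (h1 : w + Complex.I * t ≠ 0) :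
    (w + (1 - w ^ 2) / (w + Complex.I * t)) * (1 + (t : ℂ) ^ 2)⁻¹ =
      (w + Complex.I * t)⁻¹ + Complex.I * t * (1 + (t : ℂ) ^ 2)⁻¹ := by
  have h2 := one_add_ofReal_sq_ne_zero t
  field_simp
  ring_nf
  simp only [Complex.I_sq]
  ring

theorem integrable_kernel_mul {w : ℂ} (hw : 0 < w.re) {f : ℝ → ℂ} (hcont : Continuous f) {M : ℝ}
    (hM : ∀ x, ‖f x‖ ≤ M) : Integrable fun t : ℝ ↦
      (w + (1 - w ^ 2) / (w + Complex.I * t)) * ((1 + (t : ℂ) ^ 2)⁻¹ * f t) := by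
  have hu := integrable_inv_one_add_sq_mul hcont hM
  refine ((hu.const_mul w).add ((integrable_inv_add_I_mul hu hw).const_mul (1 - w ^ 2))).congr
    (.of_forall fun t ↦ ?_)
  simp only [Pi.add_apply, div_eq_mul_inv]
  ring

theorem inv_add_inv_eq_poisson {x y : ℝ} (hy : 0 < y) (t : ℝ) :
    ((y : ℂ) - x * Complex.I + Complex.I * t)⁻¹ + ((y : ℂ) + x * Complex.I - Complex.I * t)⁻¹ =
      2 * ((y / (y ^ 2 + (t - x) ^ 2) : ℝ) : ℂ) := by
  have h1 : (y : ℂ) - x * Complex.I + Complex.I * t ≠ 0 :=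
    add_I_mul_ofReal_ne_zero (w := y - x * Complex.I) (by simpa using hy) t
  have h2 : (y : ℂ) + x * Complex.I - Complex.I * t ≠ 0 := by
    have := add_I_mul_ofReal_ne_zero (w := y + x * Complex.I) (by simpa using hy) (-t)
    push_cast at this
    rwa [mul_neg, ← sub_eq_add_neg] at this
  have h3 : ((y : ℂ) - x * Complex.I + Complex.I * t) * ((y : ℂ) + x * Complex.I - Complex.I * t) =
      y ^ 2 + (t - x) ^ 2 := by
    ring_nf
    simp only [Complex.I_sq]
    ring
  push_cast
  rw [← h3]
  field_simp
  ring

theorem integral_poisson_mul (f : ℝ → ℂ) (x : ℝ) {y : ℝ} (hy : 0 < y) :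
    ∫ t : ℝ, ((y / (y ^ 2 + (t - x) ^ 2) : ℝ) : ℂ) * f t =
      ∫ u : ℝ, (((1 + u ^ 2)⁻¹ : ℝ) : ℂ) * f (x + y * u) := by
  have h := Measure.integral_comp_mul_left
    (fun v ↦ ((y / (y ^ 2 + (x + v - x) ^ 2) : ℝ) : ℂ) * f (x + v)) y
  rw [integral_add_left_eq_self (fun t ↦ ((y / (y ^ 2 + (t - x) ^ 2) : ℝ) : ℂ) * f t) x,
    abs_of_pos (inv_pos.2 hy)] at h
  rw [← inv_smul_eq_iff₀ (inv_ne_zero hy.ne'), inv_inv] at h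
  rw [← h, ← integral_smul]
  congr 1
  ext u
  rw [Complex.real_smul, ← mul_assoc, ← Complex.ofReal_mul]
  congr 2
  have : 1 + u ^ 2 ≠ 0 := by positivity
  rw [add_sub_cancel_left, mul_pow]
  field_simp

/-- After `t ↦ -t` in the second integral the terms `it/(1 + t²)` cancel, and the two conjugate
Cauchy kernels add up to twice the Poisson kernel. -/
theorem modifiedCauchyTransform_add_eq_poisson {f : ℝ → ℂ} (hcont : Continuous f) {M : ℝ}
    (hM : ∀ x, ‖f x‖ ≤ M) (x : ℝ) {y : ℝ} (hy : 0 < y) :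
    modifiedCauchyTransform f (Complex.I * (y - x * Complex.I)) +
        modifiedCauchyTransform (fun t ↦ f (-t)) (Complex.I * (y + x * Complex.I)) =
      (2 / Real.pi : ℂ) * ∫ u : ℝ, (((1 + u ^ 2)⁻¹ : ℝ) : ℂ) * f (x + y * u) := by
  have hw : 0 < ((y : ℂ) - x * Complex.I).re := by simpa using hy
  have hw' : 0 < ((y : ℂ) + x * Complex.I).re := by simpa using hy
  have hneg : Continuous fun t ↦ f (-t) := hcont.comp continuous_neg
  have h2 := integrable_kernel_mul hw' hneg (fun t ↦ hM (-t))
  rw [modifiedCauchyTransform_I_mul f hw, modifiedCauchyTransform_I_mul _ hw',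
    ← integral_neg_eq_self (fun t : ℝ ↦ ((y : ℂ) + x * Complex.I +
      (1 - ((y : ℂ) + x * Complex.I) ^ 2) / ((y : ℂ) + x * Complex.I + Complex.I * t)) *
      ((1 + (t : ℂ) ^ 2)⁻¹ * f (-t))), ← mul_add,
    ← integral_add (integrable_kernel_mul hw hcont hM) h2.comp_neg, ← integral_poisson_mul f x hy,
    div_eq_mul_one_div 2, mul_comm 2, mul_assoc, ← integral_const_mul 2]
  congr 2
  ext t
  rw [← mul_assoc, ← mul_assoc, kernel_eq_inv_add t (add_I_mul_ofReal_ne_zero hw t),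
    kernel_eq_inv_add (-t) (add_I_mul_ofReal_ne_zero hw' (-t)), neg_neg, ← add_mul, ← mul_assoc,
    ← inv_add_inv_eq_poisson hy t]
  push_cast
  ring

/-- In the variable `u = (t - x)/y` the dominating function does not depend on `y`, so the integral
is continuous at `y = 0` too. -/
theorem tendsto_integral_poisson {f : ℝ → ℂ} (hcont : Continuous f) {M : ℝ}
    (hM : ∀ x, ‖f x‖ ≤ M) (x : ℝ) :
    Tendsto (fun y : ℝ ↦ ∫ u : ℝ, (((1 + u ^ 2)⁻¹ : ℝ) : ℂ) * f (x + y * u)) (𝓝 0)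
      (𝓝 (Real.pi * f x)) := by
  have h : Continuous fun y : ℝ ↦ ∫ u : ℝ, (((1 + u ^ 2)⁻¹ : ℝ) : ℂ) * f (x + y * u) := by
    refine continuous_of_dominated (bound := fun u ↦ (1 + u ^ 2)⁻¹ * M) (fun y ↦ ?_)
      (fun y ↦ .of_forall fun u ↦ ?_) (integrable_inv_one_add_sq.mul_const M)
      (.of_forall fun u ↦ by fun_prop)
    · exact integrable_inv_one_add_sq.ofReal.aestronglyMeasurable.mul
        (by fun_prop : Continuous fun u ↦ f (x + y * u)).aestronglyMeasurable
    · rw [norm_mul, Complex.norm_real, Real.norm_of_nonneg (by positivity)]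
      gcongr
      exact hM _
  convert h.tendsto 0 using 2
  simp only [zero_mul, add_zero]
  rw [integral_mul_const, integral_complex_ofReal, integral_univ_inv_one_add_sq]

/-! ### Sufficiency. -/

theorem CompletelyMonotonicOn.exists_iteratedDeriv_eq {F : ℂ → ℂ}
    (hF : DifferentiableOn ℂ F {w | 0 < w.re}) {g : ℝ → ℝ}
    (hg : CompletelyMonotonicOn g (Ioi 0)) (hgF : ∀ y ∈ Ioi (0 : ℝ), (g y : ℂ) = F y) :
    ∃ D : ℕ → ℝ → ℝ, (∀ n, ∀ y ∈ Ioi (0 : ℝ), (D n y : ℂ) = iteratedDeriv n F y) ∧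
      ∀ n, ∀ y ∈ Ioi (0 : ℝ), 0 ≤ (-1) ^ n * D n y :=
  ⟨fun n y ↦ iteratedDerivWithin n g (Ioi 0) y,
    fun n y hy ↦ ofReal_iteratedDerivWithin_Ioi_eq hF hg.1 hgF n y hy, hg.2⟩

theorem isCharacteristicFunction_of_completelyMonotonicOn {f : ℝ → ℂ} (hcont : Continuous f)
    {M : ℝ} (hM : ∀ x, ‖f x‖ ≤ M) (hf0 : f 0 = 1) {a : ℝ} {g k : ℝ → ℝ}
    (hg : ∀ y ∈ Ioi (0 : ℝ),
      ((g y : ℝ) : ℂ) = (a : ℂ) + modifiedCauchyTransform f (Complex.I * (y : ℂ)))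
    (hgm : CompletelyMonotonicOn g (Ioi 0))
    (hk : ∀ y ∈ Ioi (0 : ℝ), ((k y : ℝ) : ℂ) =
      ((-a : ℝ) : ℂ) + modifiedCauchyTransform (fun t ↦ f (-t)) (Complex.I * (y : ℂ)))
    (hkm : CompletelyMonotonicOn k (Ioi 0)) : IsCharacteristicFunction f := by
  have hneg : Continuous fun t ↦ f (-t) := hcont.comp continuous_neg
  have hF := (differentiableOn_modifiedCauchyTransform hcont hM).const_add (a : ℂ)
  have hG := (differentiableOn_modifiedCauchyTransform hneg fun t ↦ hM (-t)).const_add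
    ((-a : ℝ) : ℂ)
  obtain ⟨D, hD, hD0⟩ := hgm.exists_iteratedDeriv_eq hF hg
  obtain ⟨E, hE, hE0⟩ := hkm.exists_iteratedDeriv_eq hG hk
  let P : ℝ → ℝ → ℂ := fun x y ↦ ∫ u : ℝ, (((1 + u ^ 2)⁻¹ : ℝ) : ℂ) * f (x + y * u)
  have hpi : (Real.pi : ℂ) ≠ 0 := by exact_mod_cast Real.pi_ne_zero
  have hP : ∀ x, Tendsto (fun n : ℕ ↦ P x (1 / (n + 1))) atTop (𝓝 (Real.pi * f x)) := fun x ↦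
    (tendsto_integral_poisson hcont hM x).comp tendsto_one_div_add_atTop_nhds_zero_nat
  have hsum : ∀ x y : ℝ, 0 < y →
      (a : ℂ) + modifiedCauchyTransform f (Complex.I * (y - x * Complex.I)) +
        (((-a : ℝ) : ℂ) +
          modifiedCauchyTransform (fun t ↦ f (-t)) (Complex.I * (y + x * Complex.I))) =
      (2 / Real.pi : ℂ) * P x y := by
    intro x y hy
    rw [← modifiedCauchyTransform_add_eq_poisson hcont hM x hy]
    push_cast
    ring
  -- Division by the value at `x = 0` normalises the mass; it is eventually nonzero since its limit
  -- is `π f(0) = π`.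
  have hne : ∀ᶠ n : ℕ in atTop, P 0 (1 / (n + 1)) ≠ 0 :=
    (hP 0).eventually_ne (by rw [hf0, mul_one]; exact hpi)
  refine isCharacteristicFunction_of_tendsto hcont.continuousAt
    (ψ := fun (n : ℕ) x ↦ P x (1 / (n + 1)) / P 0 (1 / (n + 1))) ?_ fun x ↦ ?_
  · filter_upwards [hne] with n hn
    have hy : (0 : ℝ) < 1 / (n + 1) := by positivity
    have h0 := hsum 0 _ hy
    simp only [Complex.ofReal_zero, zero_mul, sub_zero, add_zero] at h0
    have hc : (2 / Real.pi : ℂ) ≠ 0 := div_ne_zero two_ne_zero hpi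
    have h := isCharacteristicFunction_boundary_sum hF hG hD hD0 hE hE0 hy
      (by rw [h0]; exact mul_ne_zero hc hn)
    simp only [hsum _ _ hy, h0] at h
    simpa only [mul_div_mul_left _ _ hc] using h
  · have h := (hP x).div (hP 0) (by rw [hf0, mul_one]; exact hpi)
    rwa [hf0, mul_one, mul_div_cancel_left₀ _ hpi] at h

/-! ### Reflection of monotonicity conditions, and Laplace transforms. -/

theorem iteratedDerivWithin_comp_neg_Iio (k : ℝ → ℝ) (n : ℕ) {y : ℝ} (hy : y ∈ Iio (0 : ℝ)) :
    iteratedDerivWithin n (fun y ↦ k (-y)) (Iio 0) y =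
      (-1) ^ n * iteratedDerivWithin n k (Ioi 0) (-y) := by
  rw [iteratedDerivWithin_of_isOpen isOpen_Iio hy,
    iteratedDerivWithin_of_isOpen isOpen_Ioi (show -y ∈ Ioi (0 : ℝ) by simpa using hy),
    iteratedDeriv_comp_neg, smul_eq_mul]

theorem completelyMonotonicOn_Ioi_iff {k : ℝ → ℝ} :
    CompletelyMonotonicOn k (Ioi 0) ↔ AbsolutelyMonotoneOn (fun y ↦ k (-y)) (Iio 0) := by
  rw [AbsolutelyMonotoneOn.iff_iteratedDerivWithin_nonneg (uniqueDiffOn_Iio 0)]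
  refine and_congr ⟨fun h ↦ ?_, fun h ↦ ?_⟩ ⟨fun h n y hy ↦ ?_, fun h n y hy ↦ ?_⟩
  · exact h.comp contDiff_neg.contDiffOn fun y hy ↦ by simpa using hy
  · simpa [Function.comp_def] using
      h.comp contDiff_neg.contDiffOn (s := Ioi 0) fun y hy ↦ by simpa using hy
  · rw [iteratedDerivWithin_comp_neg_Iio k n hy]
    exact h n _ (by simpa using hy)
  · have hy' : -y ∈ Iio (0 : ℝ) := by simpa using hy
    simpa [iteratedDerivWithin_comp_neg_Iio k n hy'] using h n (-y) hy'

theorem completelyMonotonicOn_mgf_neg {ν : Measure ℝ} [IsFiniteMeasure ν]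
    (hν : ∀ᵐ s ∂ν, 0 ≤ s) :
    CompletelyMonotonicOn (ProbabilityTheory.mgf (fun s ↦ -s) ν) (Ioi 0) := by
  have hsub : Ioi (0 : ℝ) ⊆ interior (ProbabilityTheory.integrableExpSet (fun s ↦ -s) ν) := by
    refine interior_maximal (fun y hy ↦ ?_) isOpen_Ioi
    refine Integrable.of_bound (C := 1) (by fun_prop) ?_
    filter_upwards [hν] with s hs
    rw [Real.norm_of_nonneg (Real.exp_nonneg _), Real.exp_le_one_iff]
    exact mul_nonpos_of_nonneg_of_nonpos (le_of_lt hy) (by simpa using hs)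
  refine ⟨(ProbabilityTheory.analyticOn_mgf.mono hsub).contDiffOn (uniqueDiffOn_Ioi 0),
    fun n y hy ↦ ?_⟩
  rw [iteratedDerivWithin_of_isOpen isOpen_Ioi hy, ProbabilityTheory.iteratedDeriv_mgf (hsub hy),
    ← integral_const_mul]
  refine integral_nonneg_of_ae ?_
  filter_upwards [hν] with s hs
  rw [← mul_assoc, ← mul_pow, neg_one_mul, neg_neg]
  exact mul_nonneg (pow_nonneg hs n) (Real.exp_nonneg _)

/-! ### Necessity: the Cauchy transform of a characteristic function. -/

/-- The modified Cauchy transform of the character `t ↦ exp (i s t)` at the point `i y`. -/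
noncomputable def cauchyTransformChar (y s : ℝ) : ℝ :=
  if s ≤ 0 then Real.exp s else 2 * Real.exp (-y * s) - Real.exp (-s)

theorem continuous_cauchyTransformChar (y : ℝ) : Continuous (cauchyTransformChar y) := by
  refine Continuous.if_le (by fun_prop) (by fun_prop) continuous_id continuous_const ?_
  intro s hs
  rw [hs]
  norm_num

theorem integrable_exp_mul_cauchyTransformChar {y : ℝ} (hy : 0 < y) (t : ℝ) :
    Integrable (fun s : ℝ ↦ Complex.exp (-(t * s) * Complex.I) * (cauchyTransformChar y s : ℂ)) ∧
    ∫ s : ℝ, Complex.exp (-(t * s) * Complex.I) * (cauchyTransformChar y s : ℂ) =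
      2 * ((y + Complex.I * t)⁻¹ + Complex.I * t * (1 + (t : ℂ) ^ 2)⁻¹) := by
  have hre1 : 0 < (1 - t * Complex.I : ℂ).re := by simp
  have hre2 : (-y - t * Complex.I : ℂ).re < 0 := by simpa using hy
  have hre3 : (-1 - t * Complex.I : ℂ).re < 0 := by simp
  have e1 : EqOn (fun s : ℝ ↦ Complex.exp (-(t * s) * Complex.I) * (cauchyTransformChar y s : ℂ))
      (fun s : ℝ ↦ Complex.exp ((1 - t * Complex.I) * s)) (Iic 0) := by
    intro s hs
    simp only [cauchyTransformChar, if_pos (mem_Iic.1 hs)]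
    rw [Complex.ofReal_exp, ← Complex.exp_add]
    ring_nf
  have e2 : EqOn (fun s : ℝ ↦ Complex.exp (-(t * s) * Complex.I) * (cauchyTransformChar y s : ℂ))
      (fun s : ℝ ↦ 2 * Complex.exp ((-y - t * Complex.I) * s) -
        Complex.exp ((-1 - t * Complex.I) * s)) (Ioi 0) := by
    intro s hs
    simp only [cauchyTransformChar, if_neg (not_le.2 (mem_Ioi.1 hs))]
    push_cast
    rw [mul_sub, mul_left_comm, ← Complex.exp_add, ← Complex.exp_add]
    ring_nf
  have i1 := integrableOn_exp_mul_complex_Iic hre1 0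
  have i2 := (integrableOn_exp_mul_complex_Ioi hre2 0).const_mul 2
  have i3 := integrableOn_exp_mul_complex_Ioi hre3 0
  have j1 := i1.congr_fun e1.symm measurableSet_Iic
  have j2 := IntegrableOn.congr_fun (i2.sub i3) e2.symm measurableSet_Ioi
  have hint := j1.union j2
  rw [Iic_union_Ioi, integrableOn_univ] at hint
  refine ⟨hint, ?_⟩
  rw [← intervalIntegral.integral_Iic_add_Ioi j1 j2, setIntegral_congr_fun measurableSet_Iic e1,
    setIntegral_congr_fun measurableSet_Ioi e2, integral_sub i2 i3, integral_const_mul,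
    integral_exp_mul_complex_Iic hre1, integral_exp_mul_complex_Ioi hre2,
    integral_exp_mul_complex_Ioi hre3]
  have n1 : (1 - t * Complex.I : ℂ) ≠ 0 := fun h ↦ by simp [h] at hre1
  have n2 : (y + Complex.I * t : ℂ) ≠ 0 :=
    add_I_mul_ofReal_ne_zero (w := y) (by simpa using hy) t
  have n3 : (1 + t * Complex.I : ℂ) ≠ 0 := by
    rw [mul_comm]
    exact add_I_mul_ofReal_ne_zero (w := 1) (by simp) t
  have n4 : (1 + (t : ℂ) ^ 2) = (1 - t * Complex.I) * (1 + t * Complex.I) := by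
    ring_nf
    simp
  rw [n4, show (-y - t * Complex.I : ℂ) = -(y + Complex.I * t) by ring,
    show (-1 - t * Complex.I : ℂ) = -(1 + t * Complex.I) by ring]
  simp only [Complex.ofReal_zero, mul_zero, Complex.exp_zero]
  field_simp
  ring

/-- The Fourier transform of `cauchyTransformChar y` is elementary and equals twice the kernel at
`2πξ`; Fourier inversion then evaluates the integral without residues. -/
theorem integral_kernel_mul_exp {y : ℝ} (hy : 0 < y) (s : ℝ) :
    (1 / Real.pi : ℂ) * ∫ t : ℝ, ((y : ℂ) + (1 - (y : ℂ) ^ 2) / (y + Complex.I * t)) *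
      ((1 + (t : ℂ) ^ 2)⁻¹ * Complex.exp (t * s * Complex.I)) = cauchyTransformChar y s := by
  have hyre : 0 < (y : ℂ).re := by simpa using hy
  let h : ℝ → ℂ := fun s ↦ cauchyTransformChar y s
  have hh : Continuous h := Complex.continuous_ofReal.comp (continuous_cauchyTransformChar y)
  have hint : Integrable h := by
    simpa [h] using (integrable_exp_mul_cauchyTransformChar hy 0).1
  let k : ℝ → ℂ := fun t ↦
    ((y : ℂ) + (1 - (y : ℂ) ^ 2) / (y + Complex.I * t)) * (1 + (t : ℂ) ^ 2)⁻¹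
  have hk : Integrable k := by
    simpa [k] using integrable_kernel_mul hyre (continuous_const (y := (1 : ℂ)))
      (M := 1) (fun _ ↦ by simp)
  have hF : FourierTransform.fourier h = fun ξ : ℝ ↦ 2 * k (2 * Real.pi * ξ) := by
    ext ξ
    rw [Real.fourier_real_eq_integral_exp_smul]
    have := (integrable_exp_mul_cauchyTransformChar hy (2 * Real.pi * ξ)).2
    rw [← kernel_eq_inv_add _ (add_I_mul_ofReal_ne_zero hyre _)] at this
    rw [← this]
    congr 1
    ext v
    rw [smul_eq_mul]
    congr 3
    push_cast
    ring
  have hpi : 2 * Real.pi ≠ 0 := by positivity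
  have hFint : Integrable (FourierTransform.fourier h) := by
    rw [hF]
    exact (hk.comp_mul_left' hpi).const_mul 2
  have hinv := congrFun (hh.fourierInv_fourier_eq hint hFint) s
  rw [Real.fourierInv_eq', hF] at hinv
  change _ = h s
  rw [← hinv]
  have hsub := Measure.integral_comp_mul_left
    (fun t : ℝ ↦ 2 * (k t * Complex.exp (t * s * Complex.I))) (2 * Real.pi)
  rw [abs_of_pos (by positivity), integral_const_mul 2 (μ := volume)
    (fun t : ℝ ↦ k t * Complex.exp (t * s * Complex.I)), Complex.real_smul] at hsub
  have hpi' : (Real.pi : ℂ) ≠ 0 := by exact_mod_cast Real.pi_ne_zero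
  calc _ = (((2 * Real.pi)⁻¹ : ℝ) : ℂ) *
        (2 * ∫ t : ℝ, k t * Complex.exp (t * s * Complex.I)) := by
        simp only [k, mul_assoc _ _ (Complex.exp _)]
        generalize (∫ t : ℝ, (_ : ℂ)) = J
        push_cast
        field_simp
    _ = _ := by
        rw [← hsub]
        congr 1
        ext v
        simp only [smul_eq_mul, RCLike.inner_apply, conj_trivial]
        push_cast
        ring_nf

theorem modifiedCauchyTransform_charFun (σ : Measure ℝ) [IsProbabilityMeasure σ] {y : ℝ}
    (hy : 0 < y) :
    modifiedCauchyTransform (charFun σ) (Complex.I * y) =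
      ((∫ s, cauchyTransformChar y s ∂σ : ℝ) : ℂ) := by
  have hyre : 0 < (y : ℂ).re := by simpa using hy
  let k : ℝ → ℂ := fun t ↦
    ((y : ℂ) + (1 - (y : ℂ) ^ 2) / (y + Complex.I * t)) * (1 + (t : ℂ) ^ 2)⁻¹
  have hk : Integrable k := by
    simpa [k] using integrable_kernel_mul hyre (continuous_const (y := (1 : ℂ)))
      (M := 1) (fun _ ↦ by simp)
  have hint : Integrable (Function.uncurry fun t s : ℝ ↦ k t * Complex.exp (t * s * Complex.I))
      (volume.prod σ) := by
    refine (hk.comp_fst σ).mul_bdd (c := 1) ?_ (.of_forall fun p ↦ ?_)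
    · fun_prop
    · rw [← Complex.ofReal_mul, Complex.norm_exp_ofReal_mul_I]
  rw [modifiedCauchyTransform_I_mul _ hyre, ← integral_complex_ofReal]
  simp only [← integral_kernel_mul_exp hy]
  rw [integral_const_mul]
  congr 1
  have hswap := integral_integral_swap hint
  simp only [k, mul_assoc _ _ (Complex.exp _)] at hswap
  rw [← hswap]
  congr 1
  ext t
  rw [charFun_apply_real, integral_const_mul, integral_const_mul]

theorem integrable_sign_mul_exp (σ : Measure ℝ) [IsFiniteMeasure σ] :
    Integrable (fun s ↦ Real.sign s * Real.exp (-|s|)) σ := by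
  have hm : Measurable Real.sign :=
    Measurable.ite measurableSet_Iio measurable_const
      (Measurable.ite measurableSet_Ioi measurable_const measurable_const)
  refine Integrable.of_bound (C := 1) (hm.mul (by fun_prop)).aestronglyMeasurable
    (.of_forall fun s ↦ ?_)
  rw [norm_mul, Real.norm_of_nonneg (Real.exp_nonneg _)]
  refine mul_le_one₀ ?_ (Real.exp_nonneg _) (by simp)
  rcases Real.sign_apply_eq s with h | h | h <;> simp [h]

theorem integrable_cauchyTransformChar (σ : Measure ℝ) [IsFiniteMeasure σ] {y : ℝ} (hy : 0 < y) :
    Integrable (cauchyTransformChar y) σ := by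
  refine Integrable.of_bound (C := 3) (continuous_cauchyTransformChar y).aestronglyMeasurable
    (.of_forall fun s ↦ ?_)
  rw [cauchyTransformChar, Real.norm_eq_abs]
  split_ifs with hs
  · rw [abs_of_nonneg (Real.exp_nonneg _)]
    linarith [Real.exp_le_one_iff.2 hs]
  · rw [not_le] at hs
    have h1 : Real.exp (-y * s) ≤ 1 := Real.exp_le_one_iff.2 (by nlinarith)
    have h2 : Real.exp (-s) ≤ 1 := Real.exp_le_one_iff.2 (by linarith)
    have h3 := Real.exp_nonneg (-y * s)
    have h4 := Real.exp_nonneg (-s)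
    rw [abs_le]
    constructor <;> linarith

/-- This dictates the choice of `a`: nothing remains for `s < 0`, while `e^{-ys}` counts once at `s
= 0` and twice for `s > 0`. -/
theorem sign_mul_exp_add_cauchyTransformChar (y s : ℝ) :
    Real.sign s * Real.exp (-|s|) + cauchyTransformChar y s =
      (Ici 0).indicator (fun s ↦ Real.exp (y * -s)) s +
        (Ioi 0).indicator (fun s ↦ Real.exp (y * -s)) s := by
  rcases lt_trichotomy s 0 with hs | rfl | hs
  · simp [cauchyTransformChar, Real.sign_of_neg hs, abs_of_neg hs, hs.le, hs.not_ge]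
  · simp [cauchyTransformChar]
  · simp [cauchyTransformChar, Real.sign_of_pos hs, abs_of_pos hs, hs.le, hs.not_ge, hs]
    ring

theorem exists_completelyMonotonicOn_eq_charFun (σ : Measure ℝ) [IsProbabilityMeasure σ] :
    ∃ g : ℝ → ℝ, (∀ y ∈ Ioi (0 : ℝ), ((g y : ℝ) : ℂ) =
      ((∫ s, Real.sign s * Real.exp (-|s|) ∂σ : ℝ) : ℂ) +
        modifiedCauchyTransform (charFun σ) (Complex.I * (y : ℂ))) ∧
      CompletelyMonotonicOn g (Ioi 0) := by
  have h1 : ∀ᵐ s ∂(σ.restrict (Ici 0)), 0 ≤ s := ae_restrict_mem measurableSet_Ici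
  have h2 : ∀ᵐ s ∂(σ.restrict (Ioi 0)), 0 ≤ s :=
    (ae_restrict_mem measurableSet_Ioi).mono fun s hs ↦ le_of_lt hs
  refine ⟨_, fun y hy ↦ ?_, completelyMonotonicOn_mgf_neg
    (ν := σ.restrict (Ici 0) + σ.restrict (Ioi 0)) (ae_add_measure_iff.2 ⟨h1, h2⟩)⟩
  rw [modifiedCauchyTransform_charFun σ hy, ← Complex.ofReal_add,
    ← integral_add (integrable_sign_mul_exp σ) (integrable_cauchyTransformChar σ hy)]
  congr 1
  have hb : ∀ {ν : Measure ℝ} [IsFiniteMeasure ν], (∀ᵐ s ∂ν, 0 ≤ s) →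
      Integrable (fun s ↦ Real.exp (y * -s)) ν := by
    intro ν _ hν
    refine Integrable.of_bound (C := 1) (by fun_prop) ?_
    filter_upwards [hν] with s hs
    rw [Real.norm_of_nonneg (Real.exp_nonneg _), Real.exp_le_one_iff]
    exact mul_nonpos_of_nonneg_of_nonpos (le_of_lt hy) (by simpa using hs)
  simp only [sign_mul_exp_add_cauchyTransformChar]
  rw [integral_add ((integrable_indicator_iff measurableSet_Ici).2 (hb h1))
    ((integrable_indicator_iff measurableSet_Ioi).2 (hb h2)),
    integral_indicator measurableSet_Ici, integral_indicator measurableSet_Ioi,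
    ProbabilityTheory.mgf, integral_add_measure (hb h1) (hb h2)]

end

/-- A bounded continuous `f : ℝ → ℂ` with `f 0 = 1` is a characteristic function iff for some real
constant `a` the function `y ↦ a + K_f(iy)` is real-valued and completely monotonic on `(0, ∞)`, and
`y ↦ -(a + K_f(iy))` is real-valued and absolutely monotonic on `(-∞, 0)`. -/
theorem theorem2 (f : ℝ → ℂ) (hcont : Continuous f) (hbdd : ∃ M : ℝ, ∀ x : ℝ, ‖f x‖ ≤ M)
    (hf0 : f 0 = 1) :
    IsCharacteristicFunction f ↔
      ∃ a : ℝ,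
        (∃ g : ℝ → ℝ,
          (∀ y ∈ Ioi (0 : ℝ),
            ((g y : ℝ) : ℂ) = (a : ℂ) + modifiedCauchyTransform f (Complex.I * (y : ℂ))) ∧
          CompletelyMonotonicOn g (Ioi 0)) ∧
        (∃ g : ℝ → ℝ,
          (∀ y ∈ Iio (0 : ℝ),
            ((g y : ℝ) : ℂ) = -((a : ℂ) + modifiedCauchyTransform f (Complex.I * (y : ℂ)))) ∧
          AbsolutelyMonotoneOn g (Iio 0)) := by
  obtain ⟨M, hM⟩ := hbdd
  constructor
  · rintro ⟨σ, hσ, hf⟩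
    obtain rfl : f = charFun σ := funext hf
    let τ : Measure ℝ := σ.map (fun s ↦ -1 * s)
    have hτ : IsProbabilityMeasure τ := Measure.isProbabilityMeasure_map (by fun_prop)
    have hτf : (fun t ↦ charFun σ (-t)) = charFun τ := by
      ext t
      rw [charFun_map_mul, neg_one_mul]
    obtain ⟨k, hk, hkm⟩ := exists_completelyMonotonicOn_eq_charFun τ
    refine ⟨_, exists_completelyMonotonicOn_eq_charFun σ, fun y ↦ k (-y), fun y hy ↦ ?_,
      completelyMonotonicOn_Ioi_iff.1 hkm⟩
    -- The integrand is odd, so the constant for the reflected measure is `-a`, and a single `a`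
    -- serves both conditions.
    have hneg : ∫ s, Real.sign s * Real.exp (-|s|) ∂τ =
        -∫ s, Real.sign s * Real.exp (-|s|) ∂σ := by
      rw [integral_map (by fun_prop) (integrable_sign_mul_exp τ).aestronglyMeasurable,
        ← integral_neg]
      simp [Real.sign_neg]
    rw [hk (-y) (by simpa using hy), hneg, ← hτf, modifiedCauchyTransform_comp_neg]
    push_cast
    rw [mul_neg, neg_neg]
    ring
  · rintro ⟨a, ⟨g, hg, hgm⟩, k, hk, hkm⟩
    refine isCharacteristicFunction_of_completelyMonotonicOn hcont hM hf0 hg hgm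
      (k := fun y ↦ k (-y)) (fun y hy ↦ ?_)
      (completelyMonotonicOn_Ioi_iff.2 (by simpa only [neg_neg] using hkm))
    rw [hk (-y) (by simpa using hy), modifiedCauchyTransform_comp_neg]
    push_cast
    rw [mul_neg]
    ring
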